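/- Let $\lambda>0$, and let $(c_j)_{j\ge1}$ (premium rates) and $(\mu_j)_{j\ge1}$ (mean claim sizes) be sequences of positive reals; put $\xi_j=c_j/(\lambda\mu_j)$. Fix $q$ agents, a nonempty set $Q\subseteq\{1,\dots,q\}$, numbers $K,L$ of agent and object types and type distributions $(w_k)_{k\le K}$, $(v_l)_{l\le L}$. For each $d$ consider the stochastic block model on agents $1,\dots,q$ and objects $1,\dots,d$: the types $s(i)$ of agents and $t(j)$ of objects are independent with $\mathbb P(s(i)=k)=w_k$, $\mathbb P(t(j)=l)=v_l$, and given all types the edges $i\sim j$ are mutually independent, with $\mathbb P(i\sim j\mid s(i)=k,t(j)=l)=p_{kl}=p_{kl}(d)\in[0,1]$. Let $I_j=\max_{i\in Q}\mathbb 1\{i\sim j\}$ and $$P^Q=\lambda\,\frac{\sum_{j=1}^d I_j}{\sum_{j=1}^d I_j\,c_j/\mu_j},\qquad \tfrac00:=0.$$ A realisation $c=((s(i))_{i\in Q},(t(j))_{j\ge1})$ of the type configuration $C^Q$ of $Q$ and the objects consists of types of positive probability. For such $c$ let $c_j=((s(i))_{i\in Q},t(j))$, $p(c_j)=1-\prod_{i\in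 Q}(1-p_{s(i)t(j)})$ and $\sigma^2(c)=\sum_{j=1}^d(\xi_j-1)^2p(c_j)(1-p(c_j))$. Let $N$ be distributed as the mixture, over the configurations $c$ of $Q$ and the first $d$ objects with weights $\mathbb P(C^Q=c)$, of the normal distributions with mean $\sum_{j=1}^d(\xi_j-1)p(c_j)$ and variance $\sigma^2(c)$ (a point mass if $\sigma^2(c)=0$). Assume that $p_{kl}=O(d^{-\beta})$ as $d\to\infty$ for all $k,l$, for some $\beta\in(0,1)$, and that there are constants $0<D_1<D_2$ with $D_1\le|\xi_j-1|\le D_2$ for all $j$. (i) If $d^{-\beta}=O(p_{kl})$ for all $k,l$ as well, so that all $p_{kl}$ are of exact order $d^{-\beta}$, then $\lim_{d\to\infty}|\mathbb P(P^Q<1)-\mathbb P(N>0)|=0$. (ii) Suppose that there is a constant $0<B<\infty$ with $p(c_j)\le Bd^{-\beta}$ for all realisations $c$, all $d$ and all $j\le d$, and that there are constants $m<0<M$ and numbers $\mu_d(c)\in(-\infty,m)\cup(M,\infty)$, for all realisations $c$ and all $d$, with $$\lim_{d\to\infty}\Bigl|\frac1d\sum_{j=1}^d d^{\beta}(\xi_j-1)p(c_j)-\mu_d(c)\Bigr|=0\quad\text{uniformly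 in }c.$$ Then $\lim_{d\to\infty}|\mathbb P(P^Q<1)-\mathbb P(\mu_d(C^Q)>0)|=0$. In particular, this holds for limits $\mu_d(c)=\mu(c)$ that do not depend on $d$. -/

import Mathlib

open MeasureTheory ProbabilityTheory Filter Topology Asymptotics

noncomputable section

namespace RuinNetwork

variable {Ω : Type*} [MeasurableSpace Ω] {q K L : ℕ}

/-- The stochastic block model with `q` agents and `d` objects on the probability space `(Ω, P)`.
Agent `i` has the random type `s i`, object `j` has the random type `t j`, and `E i j` is the event
that there is an edge between agent `i` and object `j`. All types are independent, agent types have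
distribution `w` and object types have distribution `v`. Given the type configuration, the edges are
mutually independent and the edge `i ∼ j` has probability `p k l` if `i` has type `k` and `j` has
type `l`. -/
structure IsStochasticBlockModel (P : Measure Ω) (w : Fin K → ℝ) (v : Fin L → ℝ) (d : ℕ)
    (p : Fin K → Fin L → ℝ) (s : Fin q → Ω → Fin K) (t : Fin d → Ω → Fin L)
    (E : Fin q → Fin d → Set Ω) : Prop where
  prob_mem : ∀ k l, p k l ∈ Set.Icc (0 : ℝ) 1
  measurableSet_edge : ∀ i j, MeasurableSet (E i j)
  cond_iIndepSet : ∀ (a : Fin q → Fin K) (b : Fin d → Fin L),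
    P {ω | (∀ i, s i ω = a i) ∧ ∀ j, t j ω = b j} ≠ 0 →
      iIndepSet (fun ij : Fin q × Fin d => E ij.1 ij.2)
        (P[|{ω | (∀ i, s i ω = a i) ∧ ∀ j, t j ω = b j}])
  cond_edge : ∀ (a : Fin q → Fin K) (b : Fin d → Fin L),
    P {ω | (∀ i, s i ω = a i) ∧ ∀ j, t j ω = b j} ≠ 0 →
      ∀ i j, (P[|{ω | (∀ i, s i ω = a i) ∧ ∀ j, t j ω = b j}]).real (E i j) = p (a i) (b j)
  measurable_agent : ∀ i, Measurable (s i)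
  measurable_object : ∀ j, Measurable (t j)
  indep_agents : iIndepFun s P
  indep_objects : iIndepFun t P
  indep_agents_objects : IndepFun (fun ω i => s i ω) (fun ω j => t j ω) P
  law_agent : ∀ i k, P.real {ω | s i ω = k} = w k
  law_object : ∀ j l, P.real {ω | t j ω = l} = v l

/-- `ξ_j = 1 / ρ_j`, where `ρ_j = lam * claimMean_j / premium_j`. -/
def xi (lam : ℝ) (premium claimMean : ℕ → ℝ) (j : ℕ) : ℝ :=
  1 / (lam * claimMean j / premium j)

/-- The indicator of the event `Q ∼ j`: some agent in `Q` has an edge to the object `j`, that is,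
the maximum over `i ∈ Q` of the indicators of `i ∼ j`. -/
def insured (Q : Finset (Fin q)) {d : ℕ} (E : Fin q → Fin d → Set Ω) (j : Fin d) : Ω → ℝ :=
  (⋃ i ∈ Q, E i j).indicator 1

/-- The network Pollaczek–Khintchine random variable `P^Q` (with the convention `0 / 0 = 0`). -/
def networkPK (Q : Finset (Fin q)) (lam : ℝ) (premium claimMean : ℕ → ℝ) {d : ℕ}
    (E : Fin q → Fin d → Set Ω) (ω : Ω) : ℝ :=
  lam * ((∑ j : Fin d, insured Q E j ω) /
    ∑ j : Fin d, insured Q E j ω * (premium j / claimMean j))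

/-- `p(c_j)`: the probability of `Q ∼ j` given that the agents in `Q` have types `a` and that the
object `j` has type `l`. -/
def connProb {Q : Finset (Fin q)} (p : Fin K → Fin L → ℝ) (a : Q → Fin K) (l : Fin L) : ℝ :=
  1 - ∏ i : Q, (1 - p (a i) l)

/-- `∑_j (ξ_j - 1) p(c_j)`, where `c` is given by the types `a` of the agents in `Q` and the types
`b` of the `d` objects. -/
def drift {Q : Finset (Fin q)} (ξ : ℕ → ℝ) (p : Fin K → Fin L → ℝ) {d : ℕ} (a : Q → Fin K)
    (b : Fin d → Fin L) : ℝ :=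
  ∑ j : Fin d, (ξ j - 1) * connProb p a (b j)

/-- `σ²(c) = ∑_j (ξ_j - 1)² p(c_j) (1 - p(c_j))`. -/
def sigmaSq {Q : Finset (Fin q)} (ξ : ℕ → ℝ) (p : Fin K → Fin L → ℝ) {d : ℕ} (a : Q → Fin K)
    (b : Fin d → Fin L) : ℝ :=
  ∑ j : Fin d, (ξ j - 1) ^ 2 * (connProb p a (b j) * (1 - connProb p a (b j)))

/-- The law of `N`: the mixture, with weights `P(C^Q = c)`, of the normal distributions with mean
`∑_j (ξ_j - 1) p(c_j)` and variance `σ²(c)`. -/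
def normalMixture (P : Measure Ω) (Q : Finset (Fin q)) (ξ : ℕ → ℝ) {d : ℕ}
    (p : Fin K → Fin L → ℝ) (s : Fin q → Ω → Fin K) (t : Fin d → Ω → Fin L) : Measure ℝ :=
  ∑ c : (Q → Fin K) × (Fin d → Fin L),
    P {ω | (∀ i : Q, s i ω = c.1 i) ∧ ∀ j, t j ω = c.2 j} •
      gaussianReal (drift ξ p c.1 c.2) (sigmaSq ξ p c.1 c.2).toNNReal

/-- The realisations of the type configuration of the agents in `Q` and of all objects: only types
that occur with positive probability are used. -/
def realisations (Q : Finset (Fin q)) (w : Fin K → ℝ) (v : Fin L → ℝ) :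
    Set ((Q → Fin K) × (ℕ → Fin L)) :=
  {c | (∀ i, 0 < w (c.1 i)) ∧ ∀ j, 0 < v (c.2 j)}

end RuinNetwork

end

namespace RuinNetwork

-- Clearing the denominator, `P^Q < 1` means that the sum `S = ∑ (ξ_j - 1) I_j` is positive or that
-- no object is connected to `Q`. Given all types, the `I_j` are independent Bernoulli variables
-- with parameters `p(c_j)`, so the question is the sign of a weighted Bernoulli sum whose mean is
-- the drift. All conditional estimates are uniform in the configuration and therefore survive
-- averaging.
--
-- In (i) the drift may be of any size relative to `σ(c)`, so a central limit theorem uniform over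
-- half-lines is needed. Replacing Bernoulli factors by Gaussian ones
-- (`norm_prod_centered_bernoulli_sub_exp_le`) changes the standardised characteristic function by
-- `O(|t|³ D / σ)`; Lévy's theorem and Pólya's theorem then apply. Uniformity over configurations
-- comes from `exists_forall_abs_sub_gaussianReal_Ioi_lt`. The exact order of the edge probabilities
-- makes `σ²(c)` at least a constant times `d^(1-β)`, and makes it exponentially unlikely that no
-- object is connected.
--
-- In (ii) the drift has the sign of `μ_d(c)` and size at least `κ d^(1-β)`, while the variance is
-- `O(d^(1-β))`. By Chebyshev's inequality, `S` has the wrong sign with probability `O(d^(β-1))`.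

-- Pólya's theorem

theorem tendstoUniformly_of_antitone {α ι : Type*} [TopologicalSpace α] [LinearOrder α]
    [OrderTopology α] [CompactSpace α] {l : Filter ι} {F : ι → α → ℝ} {G : α → ℝ}
    (hF : ∀ i, Antitone (F i)) (hG : Continuous G)
    (h : ∀ x, Tendsto (fun i => F i x) l (𝓝 (G x))) : TendstoUniformly F G l := by
  rw [← tendstoLocallyUniformly_iff_tendstoUniformly_of_compactSpace,
    Metric.tendstoLocallyUniformly_iff]
  intro ε hε x
  have hmem : G ⁻¹' Metric.ball (G x) (ε / 4) ∈ 𝓝 x :=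
    hG.continuousAt.preimage_mem_nhds (Metric.ball_mem_nhds _ (by positivity))
  obtain ⟨b, c, hx, hbc, hsub⟩ := exists_Icc_mem_subset_of_mem_nhds hmem
  refine ⟨_, hbc, ?_⟩
  have hle : b ≤ c := hx.1.trans hx.2
  -- Sandwich: `F i y` lies between `F i c` and `F i b`, which are `ε / 4`-close to `G c` and `G b`;
  -- on the interval `G` stays `ε / 4`-close to `G x`.
  filter_upwards [(h b).eventually (Metric.ball_mem_nhds _ (show 0 < ε / 4 by positivity)),
    (h c).eventually (Metric.ball_mem_nhds _ (show 0 < ε / 4 by positivity))] with i hib hic y hy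
  have h1 := hsub (Set.left_mem_Icc.2 hle)
  have h2 := hsub (Set.right_mem_Icc.2 hle)
  have h3 := hsub hy
  have h4 := hF i hy.1
  have h5 := hF i hy.2
  simp only [Set.mem_preimage, Metric.mem_ball, Real.dist_eq, abs_lt] at h1 h2 h3 hib hic ⊢
  constructor <;> linarith [h1.1, h1.2, h2.1, h2.2, h3.1, h3.2, hib.1, hib.2, hic.1, hic.2]

/-- Thresholds are taken in `EReal` because its compactness turns pointwise into uniform
convergence. Continuity is dominated convergence: as `z → x` the indicators converge except at `y =
x`, a null set. -/
theorem continuous_measureReal_coe_gt (γ : Measure ℝ) [IsProbabilityMeasure γ]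
    (hγ : ∀ x, γ {x} = 0) :
    Continuous fun x : EReal => γ.real {y : ℝ | x < (y : EReal)} := by
  have hm : ∀ x : EReal, MeasurableSet {y : ℝ | x < (y : EReal)} := fun x =>
    (isOpen_lt continuous_const continuous_coe_real_ereal).measurableSet
  have heq : (fun x : EReal => γ.real {y : ℝ | x < (y : EReal)}) =
      fun x => ∫ y, {y : ℝ | x < (y : EReal)}.indicator (fun _ => (1 : ℝ)) y ∂γ := by
    funext x
    rw [integral_indicator_const _ (hm x)]; simp
  rw [heq, continuous_iff_continuousAt]
  intro x
  refine continuousAt_of_dominated (bound := fun _ => 1)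
    (Eventually.of_forall fun z => (aestronglyMeasurable_const.indicator (hm z)))
    (Eventually.of_forall fun z => Eventually.of_forall fun y => ?_) (integrable_const _) ?_
  · by_cases hy : y ∈ {y : ℝ | z < (y : EReal)} <;> simp [hy]
  · have hne : ∀ᵐ y : ℝ ∂γ, (y : EReal) ≠ x := by
      rw [ae_iff]
      simp only [ne_eq, not_not]
      by_cases hx : ∃ r : ℝ, (r : EReal) = x
      · obtain ⟨r, rfl⟩ := hx
        simpa using hγ r
      · push Not at hx
        simp [hx]
    filter_upwards [hne] with y hy
    rcases lt_or_gt_of_ne hy with h | h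
    · refine (continuousAt_const (y := (0 : ℝ))).congr ?_
      filter_upwards [lt_mem_nhds h] with z hz
      simp [hz.le]
    · refine (continuousAt_const (y := (1 : ℝ))).congr ?_
      filter_upwards [gt_mem_nhds h] with z hz
      simp [hz]

/-- **Pólya's theorem**: convergence in distribution to an atomless law on the line is uniform over
half-lines. -/
theorem tendsto_measureReal_Ioi_sub {ν : ℕ → ProbabilityMeasure ℝ} {γ : ProbabilityMeasure ℝ}
    (h : Tendsto ν atTop (𝓝 γ)) (hγ : ∀ x, (γ : Measure ℝ) {x} = 0) (a : ℕ → ℝ) :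
    Tendsto (fun n => (ν n : Measure ℝ).real (Set.Ioi (a n)) - (γ : Measure ℝ).real (Set.Ioi (a n)))
      atTop (𝓝 0) := by
  have hU : TendstoUniformly
      (fun n (x : EReal) => (ν n : Measure ℝ).real {y : ℝ | x < (y : EReal)})
      (fun x => (γ : Measure ℝ).real {y : ℝ | x < (y : EReal)}) atTop := by
    refine tendstoUniformly_of_antitone (fun n x y hxy => ?_)
      (continuous_measureReal_coe_gt _ hγ) fun x => ?_
    · exact measureReal_mono fun z hz => lt_of_le_of_lt hxy hz
    · have hfr : (γ : Measure ℝ) (frontier {y : ℝ | x < (y : EReal)}) = 0 := by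
        induction x with
        | bot => simp
        | top => simp
        | coe r =>
          have : {y : ℝ | (r : EReal) < (y : EReal)} = Set.Ioi r := by ext; simp
          rw [this, frontier_Ioi]
          exact hγ r
      exact (ENNReal.tendsto_toReal (measure_ne_top _ _)).comp
        (ProbabilityMeasure.tendsto_measure_of_null_frontier_of_tendsto' h hfr)
  rw [Metric.tendstoUniformly_iff] at hU
  rw [Metric.tendsto_nhds]
  intro ε hε
  filter_upwards [hU ε hε] with n hn
  have h1 : {y : ℝ | ((a n : ℝ) : EReal) < (y : EReal)} = Set.Ioi (a n) := by ext; simp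
  have := hn (a n)
  rw [h1, dist_comm] at this
  simpa [Real.dist_eq] using this

-- Characteristic functions and the central limit theorem

/-- Lindeberg's replacement: factors are exchanged one at a time, all others having norm at most 1.
-/
theorem norm_prod_sub_prod_le {ι : Type*} (s : Finset ι) (f g : ι → ℂ)
    (hf : ∀ i ∈ s, ‖f i‖ ≤ 1) (hg : ∀ i ∈ s, ‖g i‖ ≤ 1) :
    ‖∏ i ∈ s, f i - ∏ i ∈ s, g i‖ ≤ ∑ i ∈ s, ‖f i - g i‖ := by
  classical
  induction s using Finset.induction_on with
  | empty => simp
  | insert i s hi ih =>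
    rw [Finset.prod_insert hi, Finset.prod_insert hi, Finset.sum_insert hi]
    have ih' := ih (fun j hj => hf j (Finset.mem_insert_of_mem hj))
      (fun j hj => hg j (Finset.mem_insert_of_mem hj))
    have hgp : ‖∏ j ∈ s, g j‖ ≤ 1 := by
      rw [norm_prod]
      exact Finset.prod_le_one (fun _ _ => norm_nonneg _)
        fun j hj => hg j (Finset.mem_insert_of_mem hj)
    have hfi := hf i (Finset.mem_insert_self _ _)
    calc ‖f i * ∏ j ∈ s, f j - g i * ∏ j ∈ s, g j‖
        = ‖f i * (∏ j ∈ s, f j - ∏ j ∈ s, g j) + (f i - g i) * ∏ j ∈ s, g j‖ := by ring_nf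
      _ ≤ ‖f i‖ * ‖∏ j ∈ s, f j - ∏ j ∈ s, g j‖ + ‖f i - g i‖ * ‖∏ j ∈ s, g j‖ := by
          refine (norm_add_le _ _).trans ?_
          rw [norm_mul, norm_mul]
      _ ≤ 1 * ‖∏ j ∈ s, f j - ∏ j ∈ s, g j‖ + ‖f i - g i‖ * 1 := by gcongr
      _ ≤ _ := by linarith

theorem norm_exp_mul_I_sub_taylor_le {θ : ℝ} (hθ : |θ| ≤ 1) :
    ‖Complex.exp (θ * Complex.I) - (1 + θ * Complex.I - θ ^ 2 / 2)‖ ≤ |θ| ^ 3 := by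
  have hn : ‖(θ : ℂ) * Complex.I‖ = |θ| := by simp
  have h := Complex.exp_bound (x := θ * Complex.I) (by rwa [hn]) (n := 3) (by norm_num)
  rw [hn] at h
  have e : ∑ m ∈ Finset.range 3, ((θ : ℂ) * Complex.I) ^ m / m.factorial =
      1 + θ * Complex.I - θ ^ 2 / 2 := by
    simp [Finset.sum_range_succ, Nat.factorial, mul_pow]; ring
  rw [e] at h
  refine h.trans ?_
  have : (0 : ℝ) ≤ |θ| ^ 3 := by positivity
  -- The constant supplied by `Complex.exp_bound` is `4 / 18`, rounded up to 1.
  norm_num [Nat.factorial]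
  nlinarith

/-- Centring cancels the linear terms, and the quadratic ones add up to the variance, as in the
Gaussian factor. Keeping `π * (1 - π)` in the error makes the summed errors proportional to the
total variance, even for small `π`. -/
theorem norm_centered_bernoulli_sub_exp_le {θ π : ℝ} (hθ : |θ| ≤ 1) (h0 : 0 ≤ π) (h1 : π ≤ 1) :
    ‖(1 - π) * Complex.exp ((-(θ * π) : ℝ) * Complex.I) +
        π * Complex.exp ((θ * (1 - π) : ℝ) * Complex.I) -
      (Real.exp (-(θ ^ 2 * (π * (1 - π)) / 2)) : ℝ)‖ ≤ 2 * |θ| ^ 3 * (π * (1 - π)) := by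
  have hθ0 := abs_nonneg θ
  have hv0 : 0 ≤ π * (1 - π) := mul_nonneg h0 (by linarith)
  have hv1 : π * (1 - π) ≤ 1 := by nlinarith
  have a1 : |-(θ * π)| = |θ| * π := by rw [abs_neg, abs_mul, abs_of_nonneg h0]
  have a2 : |θ * (1 - π)| = |θ| * (1 - π) := by
    rw [abs_mul, abs_of_nonneg (show 0 ≤ 1 - π by linarith)]
  have e1 := norm_exp_mul_I_sub_taylor_le (θ := -(θ * π)) (by rw [a1]; nlinarith)
  have e2 := norm_exp_mul_I_sub_taylor_le (θ := θ * (1 - π)) (by rw [a2]; nlinarith)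
  rw [a1] at e1
  rw [a2] at e2
  have hθ2 : θ ^ 2 ≤ 1 := by rw [← sq_abs]; nlinarith
  have hu : |-(θ ^ 2 * (π * (1 - π)) / 2)| ≤ 1 := by
    rw [abs_neg, abs_of_nonneg (by positivity)]
    nlinarith [sq_nonneg θ]
  have e3 := Real.abs_exp_sub_one_sub_id_le hu
  set A := Complex.exp ((-(θ * π) : ℝ) * Complex.I)
  set B := Complex.exp ((θ * (1 - π) : ℝ) * Complex.I)
  set R := Real.exp (-(θ ^ 2 * (π * (1 - π)) / 2))
  have key : (1 - π) * A + π * B - (R : ℂ) =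
      ((1 - π : ℝ) : ℂ) * (A - (1 + (-(θ * π) : ℝ) * Complex.I - ((-(θ * π) : ℝ) : ℂ) ^ 2 / 2)) +
      (π : ℂ) * (B - (1 + (θ * (1 - π) : ℝ) * Complex.I - ((θ * (1 - π) : ℝ) : ℂ) ^ 2 / 2)) -
      ((R - 1 - (-(θ ^ 2 * (π * (1 - π)) / 2)) : ℝ) : ℂ) := by
    push_cast; ring
  rw [key]
  refine (norm_sub_le _ _).trans ?_
  refine (add_le_add_left (norm_add_le _ _) _).trans ?_
  rw [norm_mul, norm_mul, Complex.norm_real, Complex.norm_real, Complex.norm_real, Real.norm_eq_abs,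
    Real.norm_eq_abs, Real.norm_eq_abs, abs_of_nonneg h0, abs_of_nonneg (show 0 ≤ 1 - π by linarith)]
  -- The first two bounds sum to `|θ|³ π (1 - π)` since `π + (1 - π) = 1`; the third is as large,
  -- whence the factor 2.
  have b1 : (1 - π) * (|θ| * π) ^ 3 ≤ |θ| ^ 3 * (π * (1 - π)) * π := by
    have : 0 ≤ |θ| ^ 3 * (π * (1 - π)) * (π * (1 - π)) := by positivity
    nlinarith
  have b2 : π * (|θ| * (1 - π)) ^ 3 ≤ |θ| ^ 3 * (π * (1 - π)) * (1 - π) := by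
    have : 0 ≤ |θ| ^ 3 * (π * (1 - π)) * (π * (1 - π)) := by positivity
    nlinarith
  have b3 : (-(θ ^ 2 * (π * (1 - π)) / 2)) ^ 2 ≤ |θ| ^ 3 * (π * (1 - π)) := by
    have h4 : |θ| ^ 4 ≤ |θ| ^ 3 := pow_le_pow_of_le_one hθ0 hθ (by norm_num)
    have h5 : (π * (1 - π)) ^ 2 ≤ π * (1 - π) := by nlinarith
    calc (-(θ ^ 2 * (π * (1 - π)) / 2)) ^ 2 = |θ| ^ 4 * (π * (1 - π)) ^ 2 / 4 := by
          have : |θ| ^ 4 = θ ^ 4 := by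
            rw [show (4 : ℕ) = 2 * 2 by norm_num, pow_mul, pow_mul, sq_abs]
          rw [this]; ring
      _ ≤ |θ| ^ 3 * (π * (1 - π)) / 4 := by gcongr
      _ ≤ _ := by
          have : 0 ≤ |θ| ^ 3 * (π * (1 - π)) := by positivity
          linarith
  have c1 := mul_le_mul_of_nonneg_left e1 (show 0 ≤ 1 - π by linarith)
  have c2 := mul_le_mul_of_nonneg_left e2 h0
  linarith

theorem norm_one_sub_add_mul_le_one {π : ℝ} (h0 : 0 ≤ π) (h1 : π ≤ 1) (a b : ℝ) :
    ‖(1 - π) * Complex.exp (a * Complex.I) + π * Complex.exp (b * Complex.I)‖ ≤ 1 := by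
  refine (norm_add_le _ _).trans ?_
  rw [norm_mul, norm_mul, Complex.norm_exp_ofReal_mul_I, Complex.norm_exp_ofReal_mul_I,
    ← Complex.ofReal_one, ← Complex.ofReal_sub, Complex.norm_real, Complex.norm_real,
    Real.norm_eq_abs, Real.norm_eq_abs, abs_of_nonneg h0, abs_of_nonneg (by linarith)]
  linarith

/-- A quantitative Gaussian approximation for the characteristic function of a centred weighted sum
of independent Bernoulli variables. -/
theorem norm_prod_centered_bernoulli_sub_exp_le {ι : Type*} [Fintype ι] {D τ : ℝ} {x π : ι → ℝ}
    (hx : ∀ j, |x j| ≤ D) (hπ : ∀ j, π j ∈ Set.Icc (0 : ℝ) 1) (hτ : |τ| * D ≤ 1) :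
    ‖∏ j, ((1 - π j) * Complex.exp ((-(τ * x j * π j) : ℝ) * Complex.I) +
        π j * Complex.exp ((τ * x j * (1 - π j) : ℝ) * Complex.I)) -
      (Real.exp (-(τ ^ 2 * (∑ j, x j ^ 2 * (π j * (1 - π j))) / 2)) : ℝ)‖ ≤
      2 * |τ| ^ 3 * D * ∑ j, x j ^ 2 * (π j * (1 - π j)) := by
  have hexp : ((Real.exp (-(τ ^ 2 * (∑ j, x j ^ 2 * (π j * (1 - π j))) / 2)) : ℝ) : ℂ) =
      ∏ j, ((Real.exp (-((τ * x j) ^ 2 * (π j * (1 - π j)) / 2)) : ℝ) : ℂ) := by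
    rw [← Complex.ofReal_prod, ← Real.exp_sum]
    congr 2
    rw [Finset.sum_neg_distrib, Finset.mul_sum, Finset.sum_div]
    congr 1
    exact Finset.sum_congr rfl fun j _ => by ring
  rw [hexp]
  refine (norm_prod_sub_prod_le _ _ _
    (fun j _ => norm_one_sub_add_mul_le_one (hπ j).1 (hπ j).2 _ _) fun j _ => ?_).trans ?_
  · rw [Complex.norm_real, Real.norm_eq_abs, abs_of_pos (Real.exp_pos _), Real.exp_le_one_iff]
    have : 0 ≤ (τ * x j) ^ 2 * (π j * (1 - π j)) / 2 :=
      div_nonneg (mul_nonneg (sq_nonneg _)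
        (mul_nonneg (hπ j).1 (by linarith [(hπ j).2]))) (by norm_num)
    linarith
  · rw [Finset.mul_sum]
    refine Finset.sum_le_sum fun j _ => ?_
    have h1 : |τ * x j| ≤ 1 := by
      rw [abs_mul]
      exact (mul_le_mul_of_nonneg_left (hx j) (abs_nonneg _)).trans hτ
    refine (norm_centered_bernoulli_sub_exp_le h1 (hπ j).1 (hπ j).2).trans ?_
    have hv : 0 ≤ π j * (1 - π j) := mul_nonneg (hπ j).1 (by linarith [(hπ j).2])
    -- Lyapunov's step: one power of `|x j|` is traded for `D`, leaving the variance term.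
    have h2 : |x j| ^ 3 ≤ D * x j ^ 2 := by
      rw [← sq_abs (x j)]
      nlinarith [hx j, sq_nonneg (|x j|)]
    rw [abs_mul, mul_pow]
    calc 2 * (|τ| ^ 3 * |x j| ^ 3) * (π j * (1 - π j))
        ≤ 2 * (|τ| ^ 3 * (D * x j ^ 2)) * (π j * (1 - π j)) := by gcongr
      _ = _ := by ring

/-- The shift by the mean contributes a phase that splits over `j` and centres each Bernoulli
factor. -/
theorem charFun_map_standardize {ι : Type*} [Fintype ι] {x π : ι → ℝ} {ρ : Measure ℝ}
    (hρ : ∀ t : ℝ, charFun ρ t = ∏ j, ((1 - π j) + π j * Complex.exp ((t * x j : ℝ) * Complex.I)))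
    (r t : ℝ) :
    charFun (ρ.map fun y => (y - ∑ j, x j * π j) / r) t =
      ∏ j, ((1 - π j) * Complex.exp ((-(t / r * x j * π j) : ℝ) * Complex.I) +
        π j * Complex.exp ((t / r * x j * (1 - π j) : ℝ) * Complex.I)) := by
  have hcomp : (ρ.map fun y => (y - ∑ j, x j * π j) / r) =
      (ρ.map fun y => r⁻¹ * y).map fun y => y + (-(∑ j, x j * π j) / r) := by
    rw [Measure.map_map (by fun_prop) (by fun_prop)]
    congr 1
    funext y
    simp only [Function.comp]
    ring
  rw [hcomp, charFun_map_add_const, charFun_map_mul, hρ]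
  have hin : Complex.exp ((inner ℝ (-(∑ j, x j * π j) / r) t : ℝ) * Complex.I) =
      ∏ j, Complex.exp ((-(t / r * x j * π j) : ℝ) * Complex.I) := by
    rw [← Complex.exp_sum, ← Finset.sum_mul, ← Complex.ofReal_sum]
    congr 3
    rw [Real.inner_apply, neg_div, neg_mul, Finset.sum_div, Finset.sum_mul,
      Finset.sum_neg_distrib]
    congr 1
    exact Finset.sum_congr rfl fun j _ => by ring
  rw [hin, ← Finset.prod_mul_distrib]
  refine Finset.prod_congr rfl fun j _ => ?_
  rw [add_mul, mul_assoc (π j : ℂ), ← Complex.exp_add, ← add_mul, ← Complex.ofReal_add]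
  congr 5
  ring

/-- Central limit theorem for triangular arrays of bounded weighted Bernoulli variables. -/
theorem tendsto_sub_gaussianReal_Ioi {D : ℝ} {n : ℕ → ℕ}
    {x π : (k : ℕ) → Fin (n k) → ℝ} (ρ : ℕ → Measure ℝ) [∀ k, IsProbabilityMeasure (ρ k)]
    (hx : ∀ k j, |x k j| ≤ D) (hπ : ∀ k j, π k j ∈ Set.Icc (0 : ℝ) 1)
    (hρ : ∀ k (t : ℝ), charFun (ρ k) t =
      ∏ j, ((1 - π k j) + π k j * Complex.exp ((t * x k j : ℝ) * Complex.I)))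
    (hσ : Tendsto (fun k => ∑ j, x k j ^ 2 * (π k j * (1 - π k j))) atTop atTop) :
    Tendsto (fun k => (ρ k).real (Set.Ioi 0) -
      (gaussianReal (∑ j, x k j * π k j)
        (∑ j, x k j ^ 2 * (π k j * (1 - π k j))).toNNReal).real (Set.Ioi 0)) atTop (𝓝 0) := by
  set m : ℕ → ℝ := fun k => ∑ j, x k j * π k j with hm
  set V : ℕ → ℝ := fun k => ∑ j, x k j ^ 2 * (π k j * (1 - π k j)) with hV
  set r : ℕ → ℝ := fun k => √(V k) with hr
  have hrtop : Tendsto r atTop atTop := Real.tendsto_sqrt_atTop.comp hσ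
  have hf : ∀ k, Measurable fun y : ℝ => (y - m k) / r k := fun k => by fun_prop
  have hprob : ∀ k, IsProbabilityMeasure ((ρ k).map fun y => (y - m k) / r k) := fun k =>
    Measure.isProbabilityMeasure_map (hf k).aemeasurable
  let ν : ℕ → ProbabilityMeasure ℝ := fun k => ⟨(ρ k).map fun y => (y - m k) / r k, hprob k⟩
  let γ : ProbabilityMeasure ℝ := ⟨gaussianReal 0 1, inferInstance⟩
  have hlim : Tendsto ν atTop (𝓝 γ) := by
    refine ProbabilityMeasure.tendsto_of_tendsto_charFun fun t => ?_
    -- With `τ = t / r` and `V = r²`, the error `2 |τ|³ D V` equals `2 |t|³ D / r`.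
    have hdiff : Tendsto (fun k => 2 * |t| ^ 3 * D * (r k)⁻¹) atTop (𝓝 0) := by
      simpa using (tendsto_inv_atTop_zero.comp hrtop).const_mul (2 * |t| ^ 3 * D)
    have hsmall : Tendsto (fun k => |t| * D * (r k)⁻¹) atTop (𝓝 0) := by
      simpa using (tendsto_inv_atTop_zero.comp hrtop).const_mul (|t| * D)
    rw [tendsto_iff_norm_sub_tendsto_zero]
    refine squeeze_zero' (Eventually.of_forall fun _ => norm_nonneg _) ?_ hdiff
    filter_upwards [hrtop.eventually_gt_atTop 0, hsmall.eventually_le_const (show (0 : ℝ) < 1 by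
      norm_num)] with k hk hk1
    have hrV : r k ^ 2 = V k := Real.sq_sqrt (Real.sqrt_pos.1 hk).le
    have hd := norm_prod_centered_bernoulli_sub_exp_le (τ := t / r k) (hx k) (hπ k) (by
      rw [abs_div, abs_of_pos hk]
      calc |t| / r k * D = |t| * D * (r k)⁻¹ := by ring
        _ ≤ 1 := hk1)
    have h1 : charFun (ν k : Measure ℝ) t = _ := charFun_map_standardize (hρ k) (r k) t
    have h2 : charFun (γ : Measure ℝ) t =
        (Real.exp (-((t / r k) ^ 2 * (V k) / 2)) : ℝ) := by
      change charFun (gaussianReal 0 1) t = _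
      rw [charFun_gaussianReal, ← hrV, div_pow, div_mul_cancel₀ _ (by positivity)]
      push_cast
      simp
    rw [h1, h2]
    refine hd.trans (le_of_eq ?_)
    change 2 * |t / r k| ^ 3 * D * V k = _
    rw [← hrV, abs_div, abs_of_pos hk]
    field_simp
  have hatom : ∀ y, (γ : Measure ℝ) {y} = 0 := fun y => by
    have : NullSingletonClass (gaussianReal 0 1) := nullSingletonClass_gaussianReal one_ne_zero
    exact measure_singleton (μ := gaussianReal 0 1) y
  -- Standardising moves the threshold 0 to `-m k / r k`, which need not converge; hence the need
  -- for Pólya's theorem.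
  refine (tendsto_measureReal_Ioi_sub hlim hatom fun k => -m k / r k).congr' ?_
  filter_upwards [hrtop.eventually_gt_atTop 0] with k hk
  have hrV : r k ^ 2 = V k := Real.sq_sqrt (Real.sqrt_pos.1 hk).le
  have hpre : (fun y : ℝ => (y - m k) / r k) ⁻¹' Set.Ioi (-m k / r k) = Set.Ioi 0 := by
    ext y
    simp only [Set.mem_preimage, Set.mem_Ioi]
    rw [div_lt_div_iff_of_pos_right hk]
    constructor <;> intro h <;> linarith
  have hg : (gaussianReal (m k) (V k).toNNReal).map (fun y => (y - m k) / r k) =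
      gaussianReal 0 1 := by
    have : (fun y : ℝ => (y - m k) / r k) = (fun y => y / r k) ∘ fun y => y - m k := rfl
    rw [this, ← Measure.map_map (by fun_prop) (by fun_prop), gaussianReal_map_sub_const,
      gaussianReal_map_div_const]
    congr 1
    · simp
    · rw [← NNReal.coe_inj]
      push_cast
      rw [Real.coe_toNNReal _ (Real.sqrt_pos.1 hk).le, hrV,
        div_self (Real.sqrt_pos.1 hk).ne']
  congr 1
  · change ((ρ k).map fun y => (y - m k) / r k).real _ = _
    rw [map_measureReal_apply (hf k) measurableSet_Ioi, hpre]
  · change (gaussianReal 0 1).real _ = _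
    rw [← hg, map_measureReal_apply (hf k) measurableSet_Ioi, hpre]

/-- Gaussian approximation of weighted Bernoulli sums, uniformly over all sums of large variance. -/
theorem exists_forall_abs_sub_gaussianReal_Ioi_lt (D : ℝ) {ε : ℝ} (hε : 0 < ε) :
    ∃ T : ℝ, ∀ (n : ℕ) (x π : Fin n → ℝ) (ρ : Measure ℝ), IsProbabilityMeasure ρ →
      (∀ j, |x j| ≤ D) → (∀ j, π j ∈ Set.Icc (0 : ℝ) 1) →
      (∀ t : ℝ, charFun ρ t =
        ∏ j, ((1 - π j) + π j * Complex.exp ((t * x j : ℝ) * Complex.I))) →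
      T ≤ ∑ j, x j ^ 2 * (π j * (1 - π j)) →
      |ρ.real (Set.Ioi 0) - (gaussianReal (∑ j, x j * π j)
        (∑ j, x j ^ 2 * (π j * (1 - π j))).toNNReal).real (Set.Ioi 0)| < ε := by
  -- If every `T` fails, counterexamples for `T = k` form a triangular array with variances tending
  -- to infinity, against the limit theorem.
  by_contra! hcon
  choose n x π ρ hρp hx hπ hρ hT hfar using fun k : ℕ => hcon k
  have h := tendsto_sub_gaussianReal_Ioi ρ hx hπ hρ
    (tendsto_atTop_mono hT tendsto_natCast_atTop_atTop)
  rw [Metric.tendsto_nhds] at h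
  obtain ⟨k, hk⟩ := (h ε hε).exists
  rw [Real.dist_eq, sub_zero] at hk
  exact absurd hk (not_lt.2 (hfar k))

-- Independence of the connection events

theorem iIndepSet.compl {Ω ι : Type*} [MeasurableSpace Ω] {ν : Measure Ω} {U : ι → Set Ω}
    (h : iIndepSet U ν) : iIndepSet (fun j => (U j)ᶜ) ν := by
  rw [iIndepSet_iff] at h ⊢
  intro s f hf
  refine h s fun i hi => ?_
  have h1 := hf i hi
  have hle : MeasurableSpace.generateFrom {(U i)ᶜ} ≤ MeasurableSpace.generateFrom {U i} := by
    refine MeasurableSpace.generateFrom_le fun t ht => ?_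
    rw [Set.mem_singleton_iff.1 ht]
    exact (MeasurableSpace.measurableSet_generateFrom (Set.mem_singleton _)).compl
  exact hle _ h1

theorem measureReal_iInter_compl {Ω ι : Type*} [MeasurableSpace Ω] [Fintype ι] {ν : Measure Ω}
    [IsProbabilityMeasure ν] {U : ι → Set Ω} (hU : ∀ j, MeasurableSet (U j))
    (h : iIndepSet U ν) : ν.real (⋂ j, (U j)ᶜ) = ∏ j, (1 - ν.real (U j)) := by
  have h1 := (iIndepSet.compl h).meas_biInter Finset.univ
  simp only [Finset.mem_univ, Set.iInter_true] at h1
  rw [measureReal_def, h1, ENNReal.toReal_prod]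
  exact Finset.prod_congr rfl fun j _ => probReal_compl_eq_one_sub (hU j)

theorem measure_biInter_compl_of_prod {Ω α β : Type*} [MeasurableSpace Ω] {ν : Measure Ω}
    {E : α → β → Set Ω} (h : iIndepSet (fun ij : α × β => E ij.1 ij.2) ν) (Q : Finset α)
    (J : Finset β) :
    ν (⋂ j ∈ J, (⋃ i ∈ Q, E i j)ᶜ) = ∏ j ∈ J, ∏ i ∈ Q, ν (E i j)ᶜ := by
  have h1 := (iIndepSet.compl h).meas_biInter (Q ×ˢ J)
  rw [Finset.prod_product_right] at h1
  rw [← h1]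
  congr 1
  ext ω
  simp only [Set.mem_iInter, Set.mem_compl_iff, Set.mem_iUnion, not_exists, Finset.mem_product,
    Prod.forall, and_imp]
  exact ⟨fun H a b ha hb => H b hb a ha, fun H b hb a ha => H a b ha hb⟩

theorem measureReal_biUnion_of_prod {Ω α β : Type*} [MeasurableSpace Ω] {ν : Measure Ω}
    [IsProbabilityMeasure ν] {E : α → β → Set Ω} (hE : ∀ i j, MeasurableSet (E i j))
    (h : iIndepSet (fun ij : α × β => E ij.1 ij.2) ν) (Q : Finset α) (j : β) :
    ν.real (⋃ i ∈ Q, E i j) = 1 - ∏ i ∈ Q, (1 - ν.real (E i j)) := by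
  have h1 := measure_biInter_compl_of_prod h Q {j}
  simp only [Finset.mem_singleton, Set.iInter_iInter_eq_left, Finset.prod_singleton] at h1
  have hm : MeasurableSet (⋃ i ∈ Q, E i j) := Q.measurableSet_biUnion fun i _ => hE i j
  have h2 : ν.real (⋃ i ∈ Q, E i j)ᶜ = ∏ i ∈ Q, (1 - ν.real (E i j)) := by
    rw [measureReal_def, h1, ENNReal.toReal_prod]
    exact Finset.prod_congr rfl fun i _ => probReal_compl_eq_one_sub (hE i j)
  rw [← h2, probReal_compl_eq_one_sub hm]
  ring

/-- Complements turn unions into intersections: no edge between `Q` and `J` is an intersection over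
the rectangle `Q × J`, whose probability factorises by columns. -/
theorem iIndepSet_biUnion_of_prod {Ω α β : Type*} [MeasurableSpace Ω] {ν : Measure Ω}
    {E : α → β → Set Ω} (hE : ∀ i j, MeasurableSet (E i j))
    (h : iIndepSet (fun ij : α × β => E ij.1 ij.2) ν) (Q : Finset α) :
    iIndepSet (fun j => ⋃ i ∈ Q, E i j) ν := by
  have hm : ∀ j, MeasurableSet (⋃ i ∈ Q, E i j) := fun j =>
    Q.measurableSet_biUnion fun i _ => hE i j
  have hc : iIndepSet (fun j => (⋃ i ∈ Q, E i j)ᶜ) ν := by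
    rw [iIndepSet_iff_meas_biInter fun j => (hm j).compl]
    intro J
    rw [measure_biInter_compl_of_prod h Q J]
    refine Finset.prod_congr rfl fun j _ => ?_
    have h1 := measure_biInter_compl_of_prod h Q {j}
    simp only [Finset.mem_singleton, Set.iInter_iInter_eq_left, Finset.prod_singleton] at h1
    exact h1.symm
  simpa using iIndepSet.compl hc

theorem integral_const_mul_indicator {Ω : Type*} [MeasurableSpace Ω] {ν : Measure Ω} {U : Set Ω}
    (hU : MeasurableSet U) (x : ℝ) :
    ∫ ω, x * U.indicator 1 ω ∂ν = x * ν.real U := by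
  rw [integral_const_mul, integral_indicator_one hU]

theorem iIndepFun_const_mul_indicator {Ω ι : Type*} [MeasurableSpace Ω] {ν : Measure Ω}
    {U : ι → Set Ω} (h : iIndepSet U ν) (x : ι → ℝ) :
    iIndepFun (fun j ω => x j * (U j).indicator (1 : Ω → ℝ) ω) ν :=
  (h.iIndepFun_indicator (β := ℝ)).comp (fun j y => x j * y) fun j => measurable_const_mul (x j)

-- Moments and characteristic function of weighted sums of indicators

section WeightedSum

variable {Ω ι : Type*} [MeasurableSpace Ω] {ν : Measure Ω} [IsProbabilityMeasure ν]

theorem memLp_const_mul_indicator {U : Set Ω} (hU : MeasurableSet U) (x : ℝ) :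
    MemLp (fun ω => x * U.indicator 1 ω) 2 ν :=
  (memLp_indicator_const 2 hU (1 : ℝ) (Or.inr (measure_ne_top _ _))).const_mul x

theorem charFun_map_const_mul_indicator {U : Set Ω} (hU : MeasurableSet U) (x t : ℝ) :
    charFun (ν.map fun ω => x * U.indicator 1 ω) t =
      (1 - ν.real U) + ν.real U * Complex.exp ((t * x : ℝ) * Complex.I) := by
  have hmeas : Measurable fun ω => x * U.indicator (1 : Ω → ℝ) ω :=
    (measurable_one.indicator hU).const_mul x
  rw [charFun_apply_real, integral_map hmeas.aemeasurable (by fun_prop)]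
  have hrw : ∀ ω, Complex.exp (t * (x * U.indicator (1 : Ω → ℝ) ω : ℝ) * Complex.I) =
      1 + U.indicator (fun _ => Complex.exp ((t * x : ℝ) * Complex.I) - 1) ω := by
    intro ω
    by_cases h : ω ∈ U <;> simp [h]
  simp_rw [hrw]
  rw [integral_add (integrable_const _) ((integrable_const _).indicator hU),
    integral_indicator_const _ hU]
  simp
  ring

variable [Fintype ι] {U : ι → Set Ω}

theorem charFun_map_weighted_sum (hU : ∀ j, MeasurableSet (U j)) (h : iIndepSet U ν)
    (x : ι → ℝ) (t : ℝ) :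
    charFun (ν.map fun ω => ∑ j, x j * (U j).indicator 1 ω) t =
      ∏ j, ((1 - ν.real (U j)) + ν.real (U j) * Complex.exp ((t * x j : ℝ) * Complex.I)) := by
  rw [(iIndepFun_const_mul_indicator h x).charFun_map_fun_sum_eq_prod fun j =>
    ((measurable_one.indicator (hU j)).const_mul (x j)).aemeasurable, Finset.prod_apply]
  exact Finset.prod_congr rfl fun j _ => charFun_map_const_mul_indicator (hU j) _ _

theorem integral_weighted_sum (hU : ∀ j, MeasurableSet (U j)) (x : ι → ℝ) :
    ∫ ω, ∑ j, x j * (U j).indicator 1 ω ∂ν = ∑ j, x j * ν.real (U j) := by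
  rw [integral_finsetSum _ fun j _ => (memLp_const_mul_indicator (hU j) (x j)).integrable
    (by norm_num)]
  exact Finset.sum_congr rfl fun j _ => integral_const_mul_indicator (hU j) _

/-- Each variance is bounded by a second moment, dropping the factor `1 - ν(U j)`; this is enough
for Chebyshev's inequality. -/
theorem variance_weighted_sum_le (hU : ∀ j, MeasurableSet (U j)) (h : iIndepSet U ν)
    (x : ι → ℝ) :
    variance (fun ω => ∑ j, x j * (U j).indicator 1 ω) ν ≤ ∑ j, x j ^ 2 * ν.real (U j) := by
  have hv := IndepFun.variance_sum (μ := ν) (s := Finset.univ)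
    (X := fun j ω => x j * (U j).indicator (1 : Ω → ℝ) ω)
    (fun j _ => memLp_const_mul_indicator (hU j) (x j))
    fun i _ j _ hij => (iIndepFun_const_mul_indicator h x).indepFun hij
  have hfun : (∑ j, fun ω => x j * (U j).indicator (1 : Ω → ℝ) ω) =
      fun ω => ∑ j, x j * (U j).indicator 1 ω := by
    ext ω; simp
  rw [hfun] at hv
  rw [hv]
  refine Finset.sum_le_sum fun j _ => (variance_le_expectation_sq
    (memLp_const_mul_indicator (hU j) (x j)).1).trans (le_of_eq ?_)
  rw [← integral_const_mul_indicator (hU j)]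
  congr 1
  ext ω
  by_cases hω : ω ∈ U j <;> simp [hω]

theorem measureReal_weighted_sum_ge_le (hU : ∀ j, MeasurableSet (U j)) (h : iIndepSet U ν)
    (x : ι → ℝ) {r V : ℝ} (hr : 0 < r) (hV : ∑ j, x j ^ 2 * ν.real (U j) ≤ V) :
    ν.real {ω | r ≤ |∑ j, x j * (U j).indicator 1 ω - ∑ j, x j * ν.real (U j)|} ≤
      V / r ^ 2 := by
  have hL : MemLp (fun ω => ∑ j, x j * (U j).indicator (1 : Ω → ℝ) ω) 2 ν :=
    memLp_finsetSum _ fun j _ => memLp_const_mul_indicator (hU j) (x j)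
  have hc := meas_ge_le_variance_div_sq hL hr
  rw [integral_weighted_sum hU] at hc
  refine (ENNReal.toReal_mono ENNReal.ofReal_ne_top hc).trans ?_
  rw [ENNReal.toReal_ofReal (div_nonneg (variance_nonneg _ _) (by positivity))]
  gcongr
  exact (variance_weighted_sum_le hU h x).trans hV

end WeightedSum

-- Averaging over configurations

/-- If the conditional probabilities of `F` given a finite-valued variable `C` are within `ε` of
`g(C)`, then the probability of `F` is within `ε` of the mean of `g(C)`. -/
theorem abs_measureReal_sub_integral_le {Ω ι : Type*} [MeasurableSpace Ω] [Fintype ι]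
    [MeasurableSpace ι] [MeasurableSingletonClass ι] {P : Measure Ω}
    [IsProbabilityMeasure P] {C : Ω → ι} (hC : Measurable C) {F : Set Ω} (hF : MeasurableSet F)
    (g : ι → ℝ) {ε : ℝ}
    (h : ∀ c, P (C ⁻¹' {c}) ≠ 0 → |(P[|C ⁻¹' {c}]).real F - g c| ≤ ε) :
    |P.real F - ∫ ω, g (C ω) ∂P| ≤ ε := by
  have hC' : ∀ c, MeasurableSet (C ⁻¹' {c}) := fun c => hC (measurableSet_singleton c)
  have hprob : IsProbabilityMeasure (P.map C) := Measure.isProbabilityMeasure_map hC.aemeasurable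
  have hint : ∫ ω, g (C ω) ∂P = ∑ c, P.real (C ⁻¹' {c}) * g c := by
    rw [← integral_map hC.aemeasurable (f := g) (measurable_of_finite g).aestronglyMeasurable,
      integral_fintype .of_finite]
    exact Finset.sum_congr rfl fun c _ => by
      rw [map_measureReal_apply hC (measurableSet_singleton c), smul_eq_mul]
  have hone : ∑ c, P.real (C ⁻¹' {c}) = 1 := by
    have h1 : ∫ _ : ι, (1 : ℝ) ∂(P.map C) = 1 := by simp
    rw [integral_fintype .of_finite] at h1
    rw [← h1]
    exact Finset.sum_congr rfl fun c _ => by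
      rw [map_measureReal_apply hC (measurableSet_singleton c), smul_eq_mul, mul_one]
  have hF' : P.real F = ∑ c, P.real (C ⁻¹' {c}) * (P[|C ⁻¹' {c}]).real F := by
    have hdec : P.real F = ∑ c, P.real (C ⁻¹' {c} ∩ F) := by
      rw [← measureReal_biUnion_finset (fun a _ b _ hab => ?_) fun c _ => (hC' c).inter hF]
      · congr 1
        ext ω
        simp
      · refine Set.disjoint_left.2 fun ω h1 h2 => hab ?_
        rw [← h1.1, ← h2.1]
    rw [hdec]
    refine Finset.sum_congr rfl fun c _ => ?_
    -- A null configuration has weight zero, whatever the conditional measure is there.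
    by_cases h0 : P (C ⁻¹' {c}) = 0
    · have : P.real (C ⁻¹' {c} ∩ F) = 0 := by
        rw [measureReal_def, measure_mono_null Set.inter_subset_left h0, ENNReal.toReal_zero]
      rw [this, measureReal_def, h0, ENNReal.toReal_zero, zero_mul]
    · rw [measureReal_def, measureReal_def, measureReal_def, cond_apply (hC' c),
        ENNReal.toReal_mul, ENNReal.toReal_inv, mul_inv_cancel_left₀]
      exact (ENNReal.toReal_pos h0 (measure_ne_top _ _)).ne'
  rw [hF', hint, ← Finset.sum_sub_distrib]
  refine (Finset.abs_sum_le_sum_abs _ _).trans ?_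
  calc ∑ c, |P.real (C ⁻¹' {c}) * (P[|C ⁻¹' {c}]).real F - P.real (C ⁻¹' {c}) * g c|
      ≤ ∑ c, P.real (C ⁻¹' {c}) * ε := by
        refine Finset.sum_le_sum fun c _ => ?_
        rw [← mul_sub, abs_mul, abs_of_nonneg measureReal_nonneg]
        by_cases h0 : P (C ⁻¹' {c}) = 0
        · simp [measureReal_def, h0]
        · exact mul_le_mul_of_nonneg_left (h c h0) measureReal_nonneg
    _ = ε := by rw [← Finset.sum_mul, hone, one_mul]

-- The event `P^Q < 1` and the connection probabilities

section NetworkPK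

variable {Ω : Type*} {q d : ℕ} {Q : Finset (Fin q)} {lam : ℝ} {premium claimMean : ℕ → ℝ}
  {E : Fin q → Fin d → Set Ω}

/-- The denominator is `lam * ∑ ξ_j I_j`, positive once some object is connected. Otherwise `0 / 0 =
0` puts the outcome below 1, which is the second alternative. -/
theorem networkPK_lt_one_iff (hlam : 0 < lam) (hpremium : ∀ j, 0 < premium j)
    (hclaim : ∀ j, 0 < claimMean j) (ω : Ω) :
    networkPK Q lam premium claimMean E ω < 1 ↔
      0 < ∑ j : Fin d, (xi lam premium claimMean j - 1) * insured Q E j ω ∨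
        ω ∈ ⋂ j, (⋃ i ∈ Q, E i j)ᶜ := by
  have hnn : ∀ j, 0 ≤ insured Q E j ω := fun j =>
    Set.indicator_nonneg (fun _ _ => zero_le_one) ω
  have hrate : ∀ j, premium j / claimMean j = lam * xi lam premium claimMean j := fun j => by
    have := hpremium j
    have := hclaim j
    rw [xi]
    field_simp
  by_cases hall : ω ∈ ⋂ j, (⋃ i ∈ Q, E i j)ᶜ
  · have h0 : ∀ j, insured Q E j ω = 0 := fun j =>
      Set.indicator_of_notMem (Set.mem_iInter.1 hall j) _
    simp only [hall, or_true, iff_true]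
    simp [networkPK, h0]
  · simp only [hall, or_false]
    have hex : ∃ j, ω ∈ ⋃ i ∈ Q, E i j := by
      by_contra hcon
      push Not at hcon
      exact hall (Set.mem_iInter.2 hcon)
    obtain ⟨j₀, hj₀⟩ := hex
    have hone : insured Q E j₀ ω = 1 := Set.indicator_of_mem hj₀ _
    have hpos : 0 < ∑ j : Fin d, insured Q E j ω * (premium j / claimMean j) := by
      refine Finset.sum_pos' (fun j _ => mul_nonneg (hnn j)
        (div_pos (hpremium j) (hclaim j)).le) ⟨j₀, Finset.mem_univ _, ?_⟩
      rw [hone, one_mul]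
      exact div_pos (hpremium _) (hclaim _)
    rw [networkPK, ← mul_div_assoc, div_lt_one hpos]
    have e : ∑ j : Fin d, insured Q E j ω * (premium j / claimMean j) =
        lam * ∑ j : Fin d, insured Q E j ω * xi lam premium claimMean j := by
      rw [Finset.mul_sum]
      exact Finset.sum_congr rfl fun j _ => by rw [hrate]; ring
    rw [e, mul_lt_mul_iff_right₀ hlam, ← sub_pos, ← Finset.sum_sub_distrib]
    refine iff_of_eq (congrArg _ (Finset.sum_congr rfl fun j _ => by ring))

variable [MeasurableSpace Ω]

theorem measurable_insured (hE : ∀ i j, MeasurableSet (E i j)) (j : Fin d) :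
    Measurable (insured Q E j) :=
  measurable_one.indicator (Q.measurableSet_biUnion fun i _ => hE i j)

theorem measurableSet_networkPK_lt_one (hE : ∀ i j, MeasurableSet (E i j)) :
    MeasurableSet {ω | networkPK Q lam premium claimMean E ω < 1} := by
  refine measurableSet_lt ?_ measurable_const
  unfold networkPK
  have := measurable_insured (Q := Q) hE
  fun_prop

end NetworkPK

theorem connProb_mem_Icc {q K L : ℕ} {Q : Finset (Fin q)} {p : Fin K → Fin L → ℝ}
    (hp : ∀ k l, p k l ∈ Set.Icc (0 : ℝ) 1) (a : Q → Fin K) (l : Fin L) :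
    connProb p a l ∈ Set.Icc (0 : ℝ) 1 := by
  have h1 : ∏ i, (1 - p (a i) l) ≤ 1 :=
    Finset.prod_le_one (fun i _ => by linarith [(hp (a i) l).2]) fun i _ => by
      linarith [(hp (a i) l).1]
  have h0 : 0 ≤ ∏ i, (1 - p (a i) l) :=
    Finset.prod_nonneg fun i _ => by linarith [(hp (a i) l).2]
  constructor <;> rw [connProb] <;> linarith

theorem le_connProb {q K L : ℕ} {Q : Finset (Fin q)} {p : Fin K → Fin L → ℝ}
    (hp : ∀ k l, p k l ∈ Set.Icc (0 : ℝ) 1) (a : Q → Fin K) (l : Fin L) (i : Q) :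
    p (a i) l ≤ connProb p a l := by
  have h : ∏ j, (1 - p (a j) l) ≤ 1 - p (a i) l := by
    rw [← Finset.mul_prod_erase _ _ (Finset.mem_univ i)]
    refine mul_le_of_le_one_right (by linarith [(hp (a i) l).2]) ?_
    exact Finset.prod_le_one (fun i _ => by linarith [(hp (a i) l).2]) fun i _ => by
      linarith [(hp (a i) l).1]
  rw [connProb]
  linarith

/-- The union bound in algebraic form, `1 - ∑ x ≤ ∏ (1 - x)`. -/
theorem connProb_le_sum {q K L : ℕ} {Q : Finset (Fin q)} {p : Fin K → Fin L → ℝ}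
    (hp : ∀ k l, p k l ∈ Set.Icc (0 : ℝ) 1) (a : Q → Fin K) (l : Fin L) :
    connProb p a l ≤ ∑ i, p (a i) l := by
  have h : ∀ s : Finset Q, 1 - ∑ i ∈ s, p (a i) l ≤ ∏ i ∈ s, (1 - p (a i) l) := by
    intro s
    induction s using Finset.induction_on with
    | empty => simp
    | insert i s hi ih =>
      rw [Finset.sum_insert hi, Finset.prod_insert hi]
      have h1 : ∏ i ∈ s, (1 - p (a i) l) ≤ 1 :=
        Finset.prod_le_one (fun i _ => by linarith [(hp (a i) l).2]) fun i _ => by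
          linarith [(hp (a i) l).1]
      nlinarith [(hp (a i) l).1]
  have := h Finset.univ
  rw [connProb]
  linarith

-- Estimates for a fixed configuration

section Conditional

variable {Ω : Type*} [MeasurableSpace Ω] {ν : Measure Ω} [IsProbabilityMeasure ν]
  {q d : ℕ} {Q : Finset (Fin q)} {lam : ℝ} {premium claimMean : ℕ → ℝ}
  {E : Fin q → Fin d → Set Ω}

/-- A wrong sign forces the sum to deviate from its mean `δ` by at least `|δ| ≥ r`, so Chebyshev's
inequality applies. -/
theorem abs_networkPK_lt_one_sub_ite_le (hlam : 0 < lam) (hpremium : ∀ j, 0 < premium j)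
    (hclaim : ∀ j, 0 < claimMean j) (hE : ∀ i j, MeasurableSet (E i j))
    (hind : iIndepSet (fun j => ⋃ i ∈ Q, E i j) ν) {r V δ : ℝ} (hr : 0 < r)
    (hδ : ∑ j : Fin d, (xi lam premium claimMean j - 1) * ν.real (⋃ i ∈ Q, E i j) = δ)
    (hrδ : r ≤ |δ|)
    (hV : ∑ j : Fin d, (xi lam premium claimMean j - 1) ^ 2 * ν.real (⋃ i ∈ Q, E i j) ≤ V) :
    |ν.real {ω | networkPK Q lam premium claimMean E ω < 1} - if 0 < δ then 1 else 0| ≤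
      V / r ^ 2 := by
  have hU : ∀ j, MeasurableSet (⋃ i ∈ Q, E i j) := fun j =>
    Q.measurableSet_biUnion fun i _ => hE i j
  have hcheb := measureReal_weighted_sum_ge_le hU hind
    (fun j : Fin d => xi lam premium claimMean j - 1) hr hV
  rw [hδ] at hcheb
  refine le_trans ?_ hcheb
  have hF := measurableSet_networkPK_lt_one (Q := Q) (lam := lam) (premium := premium)
    (claimMean := claimMean) hE
  split_ifs with hpos
  · rw [abs_sub_comm, ← probReal_compl_eq_one_sub hF, abs_of_nonneg measureReal_nonneg]
    refine measureReal_mono fun ω hω => ?_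
    have hω' : ¬ (0 < ∑ j : Fin d, (xi lam premium claimMean j - 1) * insured Q E j ω) := fun h =>
      hω ((networkPK_lt_one_iff hlam hpremium hclaim ω).2 (Or.inl h))
    rw [abs_of_pos hpos] at hrδ
    change r ≤ |∑ j : Fin d, (xi lam premium claimMean j - 1) * insured Q E j ω - δ|
    rw [abs_sub_comm]
    exact (by linarith : r ≤ δ - _).trans (le_abs_self _)
  · rw [sub_zero, abs_of_nonneg measureReal_nonneg]
    refine measureReal_mono fun ω hω => ?_
    -- The weak inequality also covers the case of no connected object, where the sum is 0.
    have hω' : 0 ≤ ∑ j : Fin d, (xi lam premium claimMean j - 1) * insured Q E j ω := by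
      rcases (networkPK_lt_one_iff hlam hpremium hclaim ω).1 hω with h | h
      · exact h.le
      · have h0 : ∀ j, insured Q E j ω = 0 := fun j =>
          Set.indicator_of_notMem (Set.mem_iInter.1 h j) _
        simp [h0]
    rw [abs_of_nonpos (not_lt.1 hpos)] at hrδ
    change r ≤ |∑ j : Fin d, (xi lam premium claimMean j - 1) * insured Q E j ω - δ|
    exact (by linarith : r ≤ _ - δ).trans (le_abs_self _)

/-- The two events differ at most by the event that no object is connected, of probability `∏ (1 -
p_j) ≤ exp (-∑ p_j)`. -/
theorem abs_networkPK_lt_one_sub_le (hlam : 0 < lam) (hpremium : ∀ j, 0 < premium j)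
    (hclaim : ∀ j, 0 < claimMean j) (hE : ∀ i j, MeasurableSet (E i j))
    (hind : iIndepSet (fun j => ⋃ i ∈ Q, E i j) ν) :
    |ν.real {ω | networkPK Q lam premium claimMean E ω < 1} -
        (ν.map fun ω => ∑ j : Fin d, (xi lam premium claimMean j - 1) *
          (⋃ i ∈ Q, E i j).indicator 1 ω).real (Set.Ioi 0)| ≤
      Real.exp (-∑ j, ν.real (⋃ i ∈ Q, E i j)) := by
  have hU : ∀ j, MeasurableSet (⋃ i ∈ Q, E i j) := fun j =>
    Q.measurableSet_biUnion fun i _ => hE i j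
  have hmeas : Measurable fun ω => ∑ j : Fin d, (xi lam premium claimMean j - 1) *
      (⋃ i ∈ Q, E i j).indicator (1 : Ω → ℝ) ω :=
    Finset.measurable_sum _ fun j _ => (measurable_one.indicator (hU j)).const_mul _
  have hnone : ν.real (⋂ j, (⋃ i ∈ Q, E i j)ᶜ) ≤ Real.exp (-∑ j, ν.real (⋃ i ∈ Q, E i j)) := by
    rw [measureReal_iInter_compl hU hind, ← Finset.sum_neg_distrib, Real.exp_sum]
    refine Finset.prod_le_prod (fun j _ => sub_nonneg.2 measureReal_le_one) fun j _ => ?_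
    linarith [Real.add_one_le_exp (-ν.real (⋃ i ∈ Q, E i j))]
  rw [map_measureReal_apply hmeas measurableSet_Ioi]
  set A := (fun ω => ∑ j : Fin d, (xi lam premium claimMean j - 1) *
      (⋃ i ∈ Q, E i j).indicator (1 : Ω → ℝ) ω) ⁻¹' Set.Ioi 0 with hA
  have hF : {ω | networkPK Q lam premium claimMean E ω < 1} =
      A ∪ ⋂ j, (⋃ i ∈ Q, E i j)ᶜ := by
    ext ω
    exact networkPK_lt_one_iff hlam hpremium hclaim ω
  rw [hF, abs_of_nonneg (sub_nonneg.2 (measureReal_mono Set.subset_union_left))]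
  linarith [measureReal_union_le (μ := ν) A (⋂ j, (⋃ i ∈ Q, E i j)ᶜ)]

end Conditional

-- The block model given all types

section Model

variable {Ω : Type*} {q K L d : ℕ}
  {w : Fin K → ℝ} {v : Fin L → ℝ} {p : Fin K → Fin L → ℝ} {s : Fin q → Ω → Fin K}
  {t : Fin d → Ω → Fin L} {E : Fin q → Fin d → Set Ω}

/-- The joint type configuration of all agents and objects. -/
def typeConfig (s : Fin q → Ω → Fin K) (t : Fin d → Ω → Fin L) (ω : Ω) :
    (Fin q → Fin K) × (Fin d → Fin L) :=
  (fun i => s i ω, fun j => t j ω)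

theorem preimage_typeConfig (a : Fin q → Fin K) (b : Fin d → Fin L) :
    typeConfig s t ⁻¹' {(a, b)} = {ω | (∀ i, s i ω = a i) ∧ ∀ j, t j ω = b j} := by
  ext ω
  simp [typeConfig, funext_iff]

variable [MeasurableSpace Ω] {P : Measure Ω}

theorem IsStochasticBlockModel.measurable_typeConfig
    (h : IsStochasticBlockModel P w v d p s t E) : Measurable (typeConfig s t) :=
  (measurable_pi_lambda _ h.measurable_agent).prodMk (measurable_pi_lambda _ h.measurable_object)

theorem IsStochasticBlockModel.iIndepSet_insured
    (h : IsStochasticBlockModel P w v d p s t E) (Q : Finset (Fin q))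
    (c : (Fin q → Fin K) × (Fin d → Fin L)) (hc : P (typeConfig s t ⁻¹' {c}) ≠ 0) :
    iIndepSet (fun j => ⋃ i ∈ Q, E i j) (P[|typeConfig s t ⁻¹' {c}]) := by
  obtain ⟨a, b⟩ := c
  rw [preimage_typeConfig] at hc ⊢
  exact iIndepSet_biUnion_of_prod h.measurableSet_edge (h.cond_iIndepSet a b hc) Q

variable [IsProbabilityMeasure P]

theorem IsStochasticBlockModel.cond_insured
    (h : IsStochasticBlockModel P w v d p s t E) (Q : Finset (Fin q))
    (c : (Fin q → Fin K) × (Fin d → Fin L)) (hc : P (typeConfig s t ⁻¹' {c}) ≠ 0) (j : Fin d) :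
    (P[|typeConfig s t ⁻¹' {c}]).real (⋃ i ∈ Q, E i j) =
      connProb p (fun i : Q => c.1 i) (c.2 j) := by
  have := cond_isProbabilityMeasure hc
  obtain ⟨a, b⟩ := c
  rw [preimage_typeConfig] at hc this ⊢
  rw [measureReal_biUnion_of_prod h.measurableSet_edge (h.cond_iIndepSet a b hc) Q j, connProb,
    ← Finset.prod_coe_sort]
  simp only [h.cond_edge a b hc]

/-- The mixture sees only the types in `Q`, whereas edges are independent given the types of all
agents. Written as an expectation, it can be compared under the finer conditioning. -/
theorem normalMixture_real_Ioi (hs : ∀ i, Measurable (s i)) (ht : ∀ j, Measurable (t j))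
    (Q : Finset (Fin q)) (ξ : ℕ → ℝ) :
    (normalMixture P Q ξ p s t).real (Set.Ioi 0) =
      ∫ ω, (gaussianReal (drift ξ p (fun i : Q => (typeConfig s t ω).1 i) (typeConfig s t ω).2)
        (sigmaSq ξ p (fun i : Q => (typeConfig s t ω).1 i)
          (typeConfig s t ω).2).toNNReal).real (Set.Ioi 0) ∂P := by
  let C : Ω → (Q → Fin K) × (Fin d → Fin L) := fun ω => (fun i => s i ω, fun j => t j ω)
  have hC : Measurable C :=
    (measurable_pi_lambda (fun ω (i : Q) => s i ω) fun i => hs i).prodMk (measurable_pi_lambda _ ht)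
  have hprob : IsProbabilityMeasure (P.map C) := Measure.isProbabilityMeasure_map hC.aemeasurable
  let g : (Q → Fin K) × (Fin d → Fin L) → ℝ := fun c =>
    (gaussianReal (drift ξ p c.1 c.2) (sigmaSq ξ p c.1 c.2).toNNReal).real (Set.Ioi 0)
  change _ = ∫ ω, g (C ω) ∂P
  rw [← integral_map hC.aemeasurable (measurable_of_finite g).aestronglyMeasurable,
    integral_fintype .of_finite, normalMixture, measureReal_def, Measure.finsetSum_apply,
    ENNReal.toReal_sum fun c _ => by
      rw [Measure.smul_apply, smul_eq_mul]
      exact ENNReal.mul_ne_top (measure_ne_top _ _) (measure_ne_top _ _)]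
  refine Finset.sum_congr rfl fun c _ => ?_
  rw [map_measureReal_apply hC (measurableSet_singleton c), Measure.smul_apply, smul_eq_mul,
    ENNReal.toReal_mul, smul_eq_mul, measureReal_def]
  congr 3
  ext ω
  simp [C, Prod.ext_iff, funext_iff]

end Model

-- Unconditional estimates for a fixed number of objects

section FixedSize

variable {Ω : Type*} [MeasurableSpace Ω] {P : Measure Ω} [IsProbabilityMeasure P] {q K L d : ℕ}
  {w : Fin K → ℝ} {v : Fin L → ℝ} {p : Fin K → Fin L → ℝ} {s : Fin q → Ω → Fin K}
  {t : Fin d → Ω → Fin L} {E : Fin q → Fin d → Set Ω} {lam : ℝ} {premium claimMean : ℕ → ℝ}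

/-- The threshold `T` precedes `d` and the edge probabilities, so one `T` serves the whole limit.
One `ε` pays for the absence of connected objects, the other for the Gaussian approximation. -/
theorem IsStochasticBlockModel.exists_forall_abs_sub_normalMixture_le (hlam : 0 < lam)
    (hpremium : ∀ j, 0 < premium j) (hclaim : ∀ j, 0 < claimMean j) (Q : Finset (Fin q)) {D : ℝ}
    (hξ : ∀ j, |xi lam premium claimMean j - 1| ≤ D) {ε : ℝ} (hε : 0 < ε) :
    ∃ T : ℝ, ∀ (d : ℕ) (p : Fin K → Fin L → ℝ) (t : Fin d → Ω → Fin L)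
      (E : Fin q → Fin d → Set Ω), IsStochasticBlockModel P w v d p s t E →
      (∀ (a : Q → Fin K) (b : Fin d → Fin L), T ≤ sigmaSq (xi lam premium claimMean) p a b ∧
        Real.exp (-∑ j, connProb p a (b j)) ≤ ε) →
      |P.real {ω | networkPK Q lam premium claimMean E ω < 1} -
        (normalMixture P Q (xi lam premium claimMean) p s t).real (Set.Ioi 0)| ≤ ε + ε := by
  obtain ⟨T, hT⟩ := exists_forall_abs_sub_gaussianReal_Ioi_lt D hε
  refine ⟨T, fun d p t E h hab => ?_⟩
  rw [normalMixture_real_Ioi h.measurable_agent h.measurable_object]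
  refine abs_measureReal_sub_integral_le h.measurable_typeConfig
    (measurableSet_networkPK_lt_one h.measurableSet_edge)
    (fun c => (gaussianReal (drift (xi lam premium claimMean) p (fun i : Q => c.1 i) c.2)
      (sigmaSq (xi lam premium claimMean) p (fun i : Q => c.1 i) c.2).toNNReal).real (Set.Ioi 0))
    fun c hc => ?_
  have hν := cond_isProbabilityMeasure hc
  have hind := h.iIndepSet_insured Q c hc
  have hcp := h.cond_insured Q c hc
  have hU : ∀ j, MeasurableSet (⋃ i ∈ Q, E i j) := fun j =>
    Q.measurableSet_biUnion fun i _ => h.measurableSet_edge i j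
  obtain ⟨hσ, hexp⟩ := hab (fun i : Q => c.1 i) c.2
  have h1 := abs_networkPK_lt_one_sub_le hlam hpremium hclaim h.measurableSet_edge hind
  simp only [hcp] at h1
  have hmeas : Measurable fun ω => ∑ j : Fin d, (xi lam premium claimMean j - 1) *
      (⋃ i ∈ Q, E i j).indicator (1 : Ω → ℝ) ω :=
    Finset.measurable_sum _ fun j _ => (measurable_one.indicator (hU j)).const_mul _
  have h2 := hT d (fun j => xi lam premium claimMean j - 1)
    (fun j => connProb p (fun i : Q => c.1 i) (c.2 j)) _
    (Measure.isProbabilityMeasure_map (μ := P[|typeConfig s t ⁻¹' {c}]) hmeas.aemeasurable)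
    (fun j => hξ j) (fun j => connProb_mem_Icc h.prob_mem _ _)
    (fun τ => by
      rw [charFun_map_weighted_sum hU hind]
      simp only [hcp]) hσ
  exact (abs_sub_le _ _ _).trans (add_le_add (h1.trans hexp) h2.le)

theorem IsStochasticBlockModel.abs_sub_drift_pos_le
    (h : IsStochasticBlockModel P w v d p s t E) (hlam : 0 < lam)
    (hpremium : ∀ j, 0 < premium j) (hclaim : ∀ j, 0 < claimMean j) (Q : Finset (Fin q)) {r V : ℝ}
    (hr : 0 < r)
    (hc : ∀ c, P (typeConfig s t ⁻¹' {c}) ≠ 0 →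
      r ≤ |drift (xi lam premium claimMean) p (fun i : Q => c.1 i) c.2| ∧
      ∑ j : Fin d, (xi lam premium claimMean j - 1) ^ 2 *
        connProb p (fun i : Q => c.1 i) (c.2 j) ≤ V) :
    |P.real {ω | networkPK Q lam premium claimMean E ω < 1} -
      P.real {ω | 0 < drift (xi lam premium claimMean) p (fun i : Q => s i ω)
        fun j => t j ω}| ≤ V / r ^ 2 := by
  let g : (Fin q → Fin K) × (Fin d → Fin L) → ℝ := fun c =>
    if 0 < drift (xi lam premium claimMean) p (fun i : Q => c.1 i) c.2 then 1 else 0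
  have hint : P.real {ω | 0 < drift (xi lam premium claimMean) p (fun i : Q => s i ω)
      fun j => t j ω} = ∫ ω, g (typeConfig s t ω) ∂P := by
    have hm : MeasurableSet {ω | 0 < drift (xi lam premium claimMean) p (fun i : Q => s i ω)
        fun j => t j ω} :=
      h.measurable_typeConfig (Set.toFinite {c : (Fin q → Fin K) × (Fin d → Fin L) |
        0 < drift (xi lam premium claimMean) p (fun i : Q => c.1 i) c.2}).measurableSet
    rw [← integral_indicator_one hm]
    congr 1
  rw [hint]
  refine abs_measureReal_sub_integral_le h.measurable_typeConfig
    (measurableSet_networkPK_lt_one h.measurableSet_edge) g fun c hc0 => ?_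
  have hν := cond_isProbabilityMeasure hc0
  have hcp := h.cond_insured Q c hc0
  obtain ⟨h1, h2⟩ := hc c hc0
  refine abs_networkPK_lt_one_sub_ite_le hlam hpremium hclaim h.measurableSet_edge
    (h.iIndepSet_insured Q c hc0) hr ?_ h1 ?_
  · simp only [hcp, drift]
  · simpa only [hcp] using h2

end FixedSize

-- Asymptotics in the number of objects

theorem ae_pos_of_law {Ω : Type*} [MeasurableSpace Ω] {P : Measure Ω} [IsProbabilityMeasure P]
    {n : ℕ} {X : Ω → Fin n} {u : Fin n → ℝ} (h : ∀ k, P.real {ω | X ω = k} = u k) :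
    ∀ᵐ ω ∂P, 0 < u (X ω) := by
  have h1 : ∀ᵐ ω ∂P, ∀ k, X ω = k → 0 < u k := by
    rw [ae_all_iff]
    intro k
    by_cases hk : 0 < u k
    · exact Eventually.of_forall fun _ _ => hk
    · have h0 : P.real {ω | X ω = k} = 0 :=
        le_antisymm ((h k).trans_le (not_lt.1 hk)) measureReal_nonneg
      rw [measureReal_eq_zero_iff] at h0
      have : ∀ᵐ ω ∂P, ¬ X ω = k := by simpa [ae_iff] using h0
      filter_upwards [this] with ω hω hX
      exact absurd hX hω
  filter_upwards [h1] with ω hω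
  exact hω _ rfl

theorem eventually_forall_le_of_isBigO {ι : Type*} [Finite ι] {f : ℕ → ℝ} {g : ι → ℕ → ℝ}
    (hf : ∀ d, 0 ≤ f d) (hg : ∀ i d, 0 ≤ g i d) (h : ∀ i, f =O[atTop] g i) :
    ∃ c : ℝ, 0 < c ∧ ∀ᶠ d in atTop, ∀ i, c * f d ≤ g i d := by
  cases nonempty_fintype ι
  choose C hC hCb using fun i => (h i).exists_pos
  -- The sum dominates every `C i`; the added 1 keeps it positive for an empty index type.
  have hS : 0 < 1 + ∑ i, C i := by
    have := Finset.sum_nonneg fun i (_ : i ∈ Finset.univ) => (hC i).le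
    linarith
  refine ⟨(1 + ∑ i, C i)⁻¹, inv_pos.2 hS, ?_⟩
  rw [eventually_all]
  intro i
  filter_upwards [(hCb i).bound] with d hd
  rw [Real.norm_of_nonneg (hf d), Real.norm_of_nonneg (hg i d)] at hd
  rw [inv_mul_le_iff₀ hS]
  refine hd.trans (mul_le_mul_of_nonneg_right ?_ (hg i d))
  have := Finset.single_le_sum (fun i _ => (hC i).le) (Finset.mem_univ i)
  linarith

theorem natCast_mul_rpow_neg {d : ℕ} (hd : 0 < d) (β : ℝ) :
    (d : ℝ) * (d : ℝ) ^ (-β) = (d : ℝ) ^ (1 - β) := by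
  have : (0 : ℝ) < d := by exact_mod_cast hd
  rw [sub_eq_add_neg, Real.rpow_add this, Real.rpow_one]

theorem tendsto_natCast_rpow_one_sub {β : ℝ} (hβ : β < 1) :
    Tendsto (fun d : ℕ => (d : ℝ) ^ (1 - β)) atTop atTop :=
  (tendsto_rpow_atTop (by linarith)).comp tendsto_natCast_atTop_atTop

theorem tendsto_abs_sub_normalMixture
    {Ω : Type*} [MeasurableSpace Ω] (P : Measure Ω) [IsProbabilityMeasure P]
    {q K L : ℕ} (w : Fin K → ℝ) (v : Fin L → ℝ) (Q : Finset (Fin q)) (hQ : Q.Nonempty)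
    (lam : ℝ) (hlam : 0 < lam) (premium claimMean : ℕ → ℝ)
    (hpremium : ∀ j, 0 < premium j) (hclaim : ∀ j, 0 < claimMean j)
    (p : ℕ → Fin K → Fin L → ℝ) (s : Fin q → Ω → Fin K) (t : ℕ → Ω → Fin L)
    (E : (d : ℕ) → Fin q → Fin d → Set Ω)
    (hSBM : ∀ d, IsStochasticBlockModel P w v d (p d) s (fun j => t j) (E d))
    (β : ℝ) (hβ : β ∈ Set.Ioo (0 : ℝ) 1)
    (hp : ∀ k l, (fun d : ℕ => p d k l) =O[atTop] fun d : ℕ => (d : ℝ) ^ (-β))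
    (D₁ D₂ : ℝ) (hD₁ : 0 < D₁)
    (hξ : ∀ j, D₁ ≤ |xi lam premium claimMean j - 1| ∧ |xi lam premium claimMean j - 1| ≤ D₂)
    (hp' : ∀ k l, (fun d : ℕ => (d : ℝ) ^ (-β)) =O[atTop] fun d : ℕ => p d k l) :
    Tendsto (fun d : ℕ =>
      |P.real {ω | networkPK Q lam premium claimMean (E d) ω < 1} -
        (normalMixture P Q (xi lam premium claimMean)
          (p d) s (fun j : Fin d => t j)).real (Set.Ioi 0)|) atTop (𝓝 0) := by
  have hpow : Tendsto (fun d : ℕ => (d : ℝ) ^ (-β)) atTop (𝓝 0) :=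
    (tendsto_rpow_neg_atTop hβ.1).comp tendsto_natCast_atTop_atTop
  obtain ⟨c₀, hc₀, hlow⟩ := eventually_forall_le_of_isBigO (ι := Fin K × Fin L)
    (g := fun kl d => p d kl.1 kl.2) (fun d => Real.rpow_nonneg (Nat.cast_nonneg d) (-β))
    (fun kl d => ((hSBM d).prob_mem kl.1 kl.2).1) fun kl => hp' kl.1 kl.2
  -- This threshold makes the union bound give `p(c_j) ≤ 1/2`, so that `σ²(c)` is comparable to `∑
  -- p(c_j)`.
  have hup : ∀ᶠ d : ℕ in atTop, ∀ kl : Fin K × Fin L,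
      p d kl.1 kl.2 ≤ 1 / (2 * ((Fintype.card Q : ℝ) + 1)) := by
    rw [eventually_all]
    intro kl
    exact ((hp kl.1 kl.2).trans_tendsto hpow).eventually_le_const (by positivity)
  obtain ⟨i₀, hi₀⟩ := hQ
  have hbig := tendsto_natCast_rpow_one_sub hβ.2
  rw [Metric.tendsto_nhds]
  intro ε hε
  obtain ⟨T, hT⟩ := IsStochasticBlockModel.exists_forall_abs_sub_normalMixture_le (P := P) (s := s)
    (w := w) (v := v) hlam hpremium hclaim Q (fun j => (hξ j).2) (show 0 < ε / 3 by positivity)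
  have hT' : ∀ᶠ d : ℕ in atTop, T ≤ D₁ ^ 2 * c₀ / 2 * (d : ℝ) ^ (1 - β) :=
    (hbig.const_mul_atTop (by positivity)).eventually_ge_atTop T
  have hexp : ∀ᶠ d : ℕ in atTop, Real.exp (-(c₀ * (d : ℝ) ^ (1 - β))) ≤ ε / 3 :=
    (Real.tendsto_exp_neg_atTop_nhds_zero.comp (hbig.const_mul_atTop hc₀)).eventually_le_const
      (by positivity)
  filter_upwards [hlow, hup, hT', hexp, eventually_gt_atTop 0] with d hlow hup hT' hexp hd
  have hprob := (hSBM d).prob_mem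
  have hmain := hT d (p d) _ (E d) (hSBM d) fun a b => by
    have hconn_low : ∀ j, c₀ * (d : ℝ) ^ (-β) ≤ connProb (p d) a (b j) := fun j =>
      (hlow (a ⟨i₀, hi₀⟩, b j)).trans (le_connProb hprob a (b j) ⟨i₀, hi₀⟩)
    have hconn_up : ∀ j, connProb (p d) a (b j) ≤ 1 / 2 := fun j => by
      refine (connProb_le_sum hprob a (b j)).trans ?_
      refine (Finset.sum_le_card_nsmul _ _ _ fun i _ => hup (a i, b j)).trans ?_
      rw [Finset.card_univ, nsmul_eq_mul, mul_one_div, div_le_div_iff₀ (by positivity) two_pos]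
      linarith
    constructor
    · refine hT'.trans ?_
      have hterm : ∀ j : Fin d, D₁ ^ 2 * c₀ / 2 * (d : ℝ) ^ (-β) ≤
          (xi lam premium claimMean j - 1) ^ 2 *
            (connProb (p d) a (b j) * (1 - connProb (p d) a (b j))) := fun j => by
        have h1 : D₁ ^ 2 ≤ (xi lam premium claimMean j - 1) ^ 2 := by
          rw [← sq_abs (xi lam premium claimMean j - 1)]
          exact pow_le_pow_left₀ hD₁.le (hξ j).1 2
        have h2 : c₀ * (d : ℝ) ^ (-β) * (1 / 2) ≤
            connProb (p d) a (b j) * (1 - connProb (p d) a (b j)) :=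
          mul_le_mul (hconn_low j) (by linarith [hconn_up j]) (by norm_num)
            (connProb_mem_Icc hprob a (b j)).1
        calc D₁ ^ 2 * c₀ / 2 * (d : ℝ) ^ (-β) = D₁ ^ 2 * (c₀ * (d : ℝ) ^ (-β) * (1 / 2)) := by ring
          _ ≤ _ := mul_le_mul h1 h2 (by positivity) (sq_nonneg _)
      have hsum := Finset.card_nsmul_le_sum Finset.univ _ _ fun j _ => hterm j
      rw [Finset.card_univ, Fintype.card_fin, nsmul_eq_mul] at hsum
      rw [← natCast_mul_rpow_neg hd]
      refine le_trans (le_of_eq ?_) hsum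
      ring
    · refine le_trans (Real.exp_le_exp.2 (neg_le_neg ?_)) hexp
      have hsum := Finset.card_nsmul_le_sum Finset.univ _ _ fun j _ => hconn_low j
      rw [Finset.card_univ, Fintype.card_fin, nsmul_eq_mul] at hsum
      rw [← natCast_mul_rpow_neg hd]
      refine le_trans (le_of_eq ?_) hsum
      ring
  rw [Real.dist_eq, sub_zero, abs_abs]
  linarith

theorem tendsto_abs_sub_sign
    {Ω : Type*} [MeasurableSpace Ω] (P : Measure Ω) [IsProbabilityMeasure P]
    {q K L : ℕ} (w : Fin K → ℝ) (v : Fin L → ℝ) (Q : Finset (Fin q))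
    (lam : ℝ) (hlam : 0 < lam) (premium claimMean : ℕ → ℝ)
    (hpremium : ∀ j, 0 < premium j) (hclaim : ∀ j, 0 < claimMean j)
    (p : ℕ → Fin K → Fin L → ℝ) (s : Fin q → Ω → Fin K) (t : ℕ → Ω → Fin L)
    (E : (d : ℕ) → Fin q → Fin d → Set Ω)
    (hSBM : ∀ d, IsStochasticBlockModel P w v d (p d) s (fun j => t j) (E d))
    (β : ℝ) (hβ : β < 1) (D : ℝ) (hξ : ∀ j, |xi lam premium claimMean j - 1| ≤ D)
    (B : ℝ)
    (hB : ∀ d : ℕ, ∀ c ∈ realisations Q w v, ∀ j : Fin d,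
      connProb (p d) c.1 (c.2 j) ≤ B * (d : ℝ) ^ (-β))
    (m M : ℝ) (hm : m < 0) (hM : 0 < M) (μ : ℕ → (Q → Fin K) × (ℕ → Fin L) → ℝ)
    (hμ : ∀ d, ∀ c ∈ realisations Q w v, μ d c ∈ Set.Iio m ∪ Set.Ioi M)
    (hunif : TendstoUniformlyOn
      (fun (d : ℕ) (c : (Q → Fin K) × (ℕ → Fin L)) =>
        1 / (d : ℝ) * ((d : ℝ) ^ β * drift (xi lam premium claimMean)
          (p d) c.1 (fun j : Fin d => c.2 j)) - μ d c)
      (fun _ => 0) atTop (realisations Q w v)) :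
    Tendsto (fun d : ℕ =>
      |P.real {ω | networkPK Q lam premium claimMean (E d) ω < 1} -
        P.real {ω | 0 < μ d (fun i => s i ω, fun j => t j ω)}|) atTop (𝓝 0) := by
  have hreal : ∀ᵐ ω ∂P, ((fun i : Q => s i ω, fun j => t j ω) :
      (Q → Fin K) × (ℕ → Fin L)) ∈ realisations Q w v := by
    have h1 : ∀ᵐ ω ∂P, ∀ i : Q, 0 < w (s i ω) :=
      ae_all_iff.2 fun i => ae_pos_of_law ((hSBM 0).law_agent i)
    have h2 : ∀ᵐ ω ∂P, ∀ j, 0 < v (t j ω) :=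
      -- Object `j` is the last object of the model with `j + 1` objects.
      ae_all_iff.2 fun j => ae_pos_of_law ((hSBM (j + 1)).law_object (Fin.last j))
    filter_upwards [h1, h2] with ω hω1 hω2
    exact ⟨hω1, hω2⟩
  -- Since `|μ_d(c)| > 2κ`, a normalised drift within `κ` of it has the same sign and modulus at
  -- least `κ`.
  set κ := min M (-m) / 2 with hκ
  have hmin : 0 < min M (-m) := lt_min hM (by linarith)
  have hκ0 : 0 < κ := by positivity
  have hκM : 2 * κ ≤ M := by
    have := min_le_left M (-m)
    linarith
  have hκm : m ≤ -(2 * κ) := by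
    have := min_le_right M (-m)
    linarith
  -- This is Chebyshev's `V / r²` with `r = κ y`, `V = D² B y` and `y = d^(1-β)`.
  have hlim : Tendsto (fun d : ℕ => D ^ 2 * B / κ ^ 2 * ((d : ℝ) ^ (1 - β))⁻¹) atTop (𝓝 0) := by
    simpa using (tendsto_inv_atTop_zero.comp (tendsto_natCast_rpow_one_sub hβ)).const_mul
      (D ^ 2 * B / κ ^ 2)
  refine squeeze_zero' (Eventually.of_forall fun _ => abs_nonneg _) ?_ hlim
  rw [Metric.tendstoUniformlyOn_iff] at hunif
  filter_upwards [hunif κ hκ0, eventually_gt_atTop 0] with d hd hd0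
  have hdpos : (0 : ℝ) < d := by exact_mod_cast hd0
  set y : ℝ := (d : ℝ) ^ (1 - β) with hy
  have hypos : 0 < y := Real.rpow_pos_of_pos hdpos _
  have hscale : ∀ δ : ℝ, δ = y * (1 / (d : ℝ) * ((d : ℝ) ^ β * δ)) := fun δ => by
    have : y * (d : ℝ) ^ β = d := by
      rw [hy, ← Real.rpow_add hdpos]
      simp
    calc δ = (d : ℝ) * (1 / (d : ℝ)) * δ := by field_simp
      _ = _ := by nth_rewrite 1 [← this]; ring
  have hsign : ∀ c ∈ realisations Q w v,
      κ * y ≤ |drift (xi lam premium claimMean) (p d) c.1 fun j : Fin d => c.2 j| ∧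
      (0 < μ d c ↔ 0 < drift (xi lam premium claimMean) (p d) c.1 fun j : Fin d => c.2 j) := by
    intro c hc
    have h1 := hd c hc
    rw [dist_comm, Real.dist_eq, sub_zero, abs_lt] at h1
    set δ := drift (xi lam premium claimMean) (p d) c.1 fun j : Fin d => c.2 j
    have h2 := hscale δ
    set z := 1 / (d : ℝ) * ((d : ℝ) ^ β * δ)
    rcases hμ d c hc with hneg | hpos
    · have hneg : μ d c < m := hneg
      have hz : z ≤ -κ := by linarith [h1.2]
      have hδ : δ ≤ -(κ * y) := by rw [h2]; nlinarith
      have hky : 0 < κ * y := by positivity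
      refine ⟨by rw [abs_of_neg (by linarith)]; linarith, ?_⟩
      exact ⟨fun h => by linarith, fun h => by linarith⟩
    · have hpos : M < μ d c := hpos
      have hz : κ ≤ z := by linarith [h1.1]
      have hδ : κ * y ≤ δ := by rw [h2]; nlinarith
      have hky : 0 < κ * y := by positivity
      refine ⟨by rw [abs_of_pos (by linarith)]; linarith, ?_⟩
      exact ⟨fun _ => by linarith, fun _ => by linarith⟩
  have hae : P.real {ω | 0 < μ d (fun i => s i ω, fun j => t j ω)} =
      P.real {ω | 0 < drift (xi lam premium claimMean) (p d) (fun i : Q => s i ω)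
        fun j : Fin d => t j ω} := by
    refine measureReal_congr ?_
    filter_upwards [hreal] with ω hω
    exact propext (hsign _ hω).2
  rw [hae]
  refine ((hSBM d).abs_sub_drift_pos_le hlam hpremium hclaim Q (r := κ * y)
    (V := D ^ 2 * B * y) (by positivity) fun c hc => ?_).trans (le_of_eq ?_)
  · obtain ⟨ω, hωc, hω⟩ : ∃ ω, typeConfig s (fun j : Fin d => t j) ω = c ∧
        ((fun i : Q => s i ω, fun j => t j ω) : (Q → Fin K) × (ℕ → Fin L)) ∈
          realisations Q w v := by
      by_contra! hcon
      refine hc (measure_mono_null (fun ω hω => ?_) hreal)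
      exact hcon ω hω
    subst hωc
    refine ⟨(hsign _ hω).1, ?_⟩
    have hterm : ∀ j : Fin d, (xi lam premium claimMean j - 1) ^ 2 *
        connProb (p d) (fun i : Q => s i ω) (t j ω) ≤ D ^ 2 * (B * (d : ℝ) ^ (-β)) := fun j => by
      have h1 : (xi lam premium claimMean j - 1) ^ 2 ≤ D ^ 2 := by
        rw [← sq_abs (xi lam premium claimMean j - 1)]
        exact pow_le_pow_left₀ (abs_nonneg _) (hξ j) 2
      exact mul_le_mul h1 (hB d _ hω j) (connProb_mem_Icc (hSBM d).prob_mem _ _).1 (sq_nonneg _)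
    have hsum := Finset.sum_le_card_nsmul Finset.univ _ _ fun j _ => hterm j
    rw [Finset.card_univ, Fintype.card_fin, nsmul_eq_mul] at hsum
    refine hsum.trans (le_of_eq ?_)
    rw [hy, ← natCast_mul_rpow_neg hd0]
    ring
  · field_simp

end RuinNetwork

theorem corollary1
    {Ω : Type*} [MeasurableSpace Ω] (P : Measure Ω) [IsProbabilityMeasure P]
    {q K L : ℕ} (w : Fin K → ℝ) (v : Fin L → ℝ)
    -- the fixed set of agents
    (Q : Finset (Fin q)) (hQ : Q.Nonempty)
    -- intensity, premium rates and mean claim sizes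
    (lam : ℝ) (hlam : 0 < lam) (premium claimMean : ℕ → ℝ)
    (hpremium : ∀ j, 0 < premium j) (hclaim : ∀ j, 0 < claimMean j)
    -- for each number `d` of objects, a stochastic block model with edge probabilities `p d`
    (p : ℕ → Fin K → Fin L → ℝ) (s : Fin q → Ω → Fin K) (t : ℕ → Ω → Fin L)
    (E : (d : ℕ) → Fin q → Fin d → Set Ω)
    (hSBM : ∀ d, RuinNetwork.IsStochasticBlockModel P w v d (p d) s (fun j => t j) (E d))
    (β : ℝ) (hβ : β ∈ Set.Ioo (0 : ℝ) 1)
    (hp : ∀ k l, (fun d : ℕ => p d k l) =O[atTop] fun d : ℕ => (d : ℝ) ^ (-β))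
    (D₁ D₂ : ℝ) (hD₁ : 0 < D₁) (hD₁₂ : D₁ < D₂)
    (hξ : ∀ j, D₁ ≤ |RuinNetwork.xi lam premium claimMean j - 1| ∧
      |RuinNetwork.xi lam premium claimMean j - 1| ≤ D₂) :
    -- edge probabilities of exact order `d ^ (-β)`: approximation by the normal mixture
    ((∀ k l, (fun d : ℕ => (d : ℝ) ^ (-β)) =O[atTop] fun d : ℕ => p d k l) →
      Tendsto (fun d : ℕ =>
        |P.real {ω | RuinNetwork.networkPK Q lam premium claimMean (E d) ω < 1} -
          (RuinNetwork.normalMixture P Q (RuinNetwork.xi lam premium claimMean)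
            (p d) s (fun j : Fin d => t j)).real (Set.Ioi 0)|) atTop (𝓝 0)) ∧
    -- phase transition
    (∀ B : ℝ, 0 < B →
      (∀ d : ℕ, ∀ c ∈ RuinNetwork.realisations Q w v, ∀ j : Fin d,
        RuinNetwork.connProb (p d) c.1 (c.2 j) ≤ B * (d : ℝ) ^ (-β)) →
      ∀ m M : ℝ, m < 0 → 0 < M →
      ∀ μ : ℕ → (Q → Fin K) × (ℕ → Fin L) → ℝ,
      (∀ d, ∀ c ∈ RuinNetwork.realisations Q w v, μ d c ∈ Set.Iio m ∪ Set.Ioi M) →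
      TendstoUniformlyOn
        (fun (d : ℕ) (c : (Q → Fin K) × (ℕ → Fin L)) =>
          1 / (d : ℝ) * ((d : ℝ) ^ β * RuinNetwork.drift (RuinNetwork.xi lam premium claimMean)
            (p d) c.1 (fun j : Fin d => c.2 j)) - μ d c)
        (fun _ => 0) atTop (RuinNetwork.realisations Q w v) →
      Tendsto (fun d : ℕ =>
        |P.real {ω | RuinNetwork.networkPK Q lam premium claimMean (E d) ω < 1} -
          P.real {ω | 0 < μ d (fun i => s i ω, fun j => t j ω)}|) atTop (𝓝 0)) := by
  exact ⟨RuinNetwork.tendsto_abs_sub_normalMixture P w v Q hQ lam hlam premium claimMean hpremium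
      hclaim p s t E hSBM β hβ hp D₁ D₂ hD₁ hξ,
    fun B _ hB m M hm hM μ hμ hunif => RuinNetwork.tendsto_abs_sub_sign P w v Q lam hlam premium
      claimMean hpremium hclaim p s t E hSBM β hβ.2 D₂ (fun j => (hξ j).2) B hB m M hm hM μ hμ
      hunif⟩
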